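/- **Theorem 3.1 (Mapping of the limiting spectra).** Let $A$ be a selfadjoint operator on a complex Hilbert space $\mathcal H$, semi-bounded from below, let $a\in\mathbb R$ with $a<\inf\sigma(A)$, and let $(A-a)^{1/2}$ be the nonnegative selfadjoint square root of $A-a$. Let $\mathcal L=(\mathcal L_n)_{n\in\mathbb N}$ be an $(A-a)^{1/2}$-regular Galerkin sequence: each $\mathcal L_n$ is a finite dimensional subspace of $\operatorname{D}((A-a)^{1/2})$, and for every $f\in\operatorname{D}((A-a)^{1/2})$ there are $f_n\in\mathcal L_n$ with $\|f_n-f\|+\|(A-a)^{1/2}(f_n-f)\|\to0$. Put $\mathcal G=(\mathcal G_n)_{n\in\mathbb N}$ with $\mathcal G_n=(A-a)^{1/2}\mathcal L_n$. For a selfadjoint operator $T$ that is bounded from below, with closed quadratic form $q_T$ (the closure of $(x,y)\mapsto\langle x,Ty\rangle$ on $\operatorname{D}(T)$), and a sequence $\mathcal M=(\mathcal M_n)$ of finite dimensional subspaces of the domain of $q_T$, let $T_n:\mathcal M_n\to\mathcal M_n$ be the compression of $T$, given by $\langle x,T_ny\rangle=q_T(x,y)$ for $x,y\in\mathcal M_n$.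 The *limiting spectrum* $\sigma(T,\mathcal M)$ is the set of all $\lambda\in\mathbb R$ for which there are $n_k\to\infty$ and $\lambda_k\in\sigma(T_{n_k})$ with $\lambda_k\to\lambda$. The *limiting essential spectrum* $\sigma_{\mathrm{ess}}(T,\mathcal M)$ is the set of all $\lambda\in\sigma(T,\mathcal M)$ for which there are $n_k\to\infty$ and $x_k\in\mathcal M_{n_k}$ with $\|x_k\|=1$, $\|(T_{n_k}-\lambda)x_k\|\to0$ and $x_k\rightharpoonup0$ weakly in $\mathcal H$. Then, for every $\lambda\in\mathbb R$, $$\lambda\in\sigma(A,\mathcal L)\iff \lambda\ne a\ \text{ and }\ (\lambda-a)^{-1}\in\sigma\big((A-a)^{-1},\mathcal G\big)$$ and $$\lambda\in\sigma_{\mathrm{ess}}(A,\mathcal L)\iff \lambda\ne a\ \text{ and }\ (\lambda-a)^{-1}\in\sigma_{\mathrm{ess}}\big((A-a)^{-1},\mathcal G\big).$$ -/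

import Mathlib

open Filter Topology

namespace LimitingSpectra

variable {H : Type*} [NormedAddCommGroup H] [InnerProductSpace ℂ H]

/-! ### Unbounded operators -/

/-- The operator `A - z`, with the same domain as `A`. -/
noncomputable def shift (A : H →ₗ.[ℂ] H) (z : ℂ) : H →ₗ.[ℂ] H where
  domain := A.domain
  toFun := A.toFun - z • A.domain.subtype

/-- The spectrum of `A`: all `z` for which `A - z` has no bounded inverse defined on all of `H`.
(The inverse relation of `A - z` is the graph of a bounded everywhere defined operator exactly when
`A - z` maps its domain bijectively onto `H` and the inverse is bounded.) -/
def opSpectrum (A : H →ₗ.[ℂ] H) : Set ℂ :=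
  {z | ¬ ∃ R : H →L[ℂ] H, ∀ x y : H, (x, y) ∈ (shift A z).graph ↔ R y = x}

/-- `inf σ(A)` as an extended real number, for an operator with real spectrum. -/
noncomputable def infSpectrum (A : H →ₗ.[ℂ] H) : EReal :=
  ⨅ μ : {μ : ℝ // (μ : ℂ) ∈ opSpectrum A}, ((μ : ℝ) : EReal)

/-- `A` is semi-bounded from below. -/
def BoundedBelow (A : H →ₗ.[ℂ] H) : Prop :=
  ∃ c : ℝ, ∀ x : A.domain, c * ‖(x : H)‖ ^ 2 ≤ (inner ℂ (x : H) (A x)).re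

/-- `S` is a nonnegative selfadjoint square root of `T`. The equality `S ∘ S = T` is one of
unbounded operators, with `D(S ∘ S) = {x ∈ D(S) | S x ∈ D(S)}`. -/
def IsSqrt [CompleteSpace H] (S T : H →ₗ.[ℂ] H) : Prop :=
  IsSelfAdjoint S ∧ (∀ x : S.domain, 0 ≤ (inner ℂ (x : H) (S x)).re) ∧
    ∀ x z : H, (x, z) ∈ T.graph ↔ ∃ y : H, (x, y) ∈ S.graph ∧ (y, z) ∈ S.graph

open Classical in
/-- `T ^ (1/2)`: the (unique) nonnegative selfadjoint square root of a nonnegative selfadjoint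
operator `T`. -/
noncomputable def opSqrt [CompleteSpace H] (T : H →ₗ.[ℂ] H) : H →ₗ.[ℂ] H :=
  if h : ∃ S : H →ₗ.[ℂ] H, IsSqrt S T then h.choose else ⊥

/-- The image `S V = {S x | x ∈ V}` of a subspace `V` (contained in `D(S)`). -/
def imageSubspace (S : H →ₗ.[ℂ] H) (V : Submodule ℂ H) : Submodule ℂ H :=
  (V.comap S.domain.subtype).map S.toFun

/-! ### Galerkin sequences -/

/-- `L` is an `S`-regular Galerkin sequence: finite dimensional subspaces of `D(S)` such that each
`f ∈ D(S)` is the limit, in the graph norm of `S`, of some `u n ∈ L n`. -/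
def IsRegular (S : H →ₗ.[ℂ] H) (L : ℕ → Submodule ℂ H) : Prop :=
  (∀ n, FiniteDimensional ℂ (L n)) ∧ (∀ n, L n ≤ S.domain) ∧
    ∀ f : S.domain, ∃ u : ℕ → S.domain, (∀ n, (u n : H) ∈ L n) ∧
      Tendsto (fun n => ‖(u n : H) - f‖ + ‖S (u n) - S f‖) atTop (𝓝 0)

/-! ### Compressions in the sense of quadratic forms -/

/-- `u n ∈ D(A)` converges to `x` in the sense of the quadratic form of `A`: it converges to `x` in
`H` and is a Cauchy sequence for the form `v ↦ ⟪v, A v⟫`. For `A` selfadjoint and bounded from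
below, the limits `x` of such sequences make up the form domain of `A`. -/
def FormConverges (A : H →ₗ.[ℂ] H) (u : ℕ → A.domain) (x : H) : Prop :=
  Tendsto (fun n => (u n : H)) atTop (𝓝 x) ∧
    Tendsto (fun p : ℕ × ℕ => inner ℂ ((u p.1 - u p.2 : A.domain) : H) (A (u p.1 - u p.2)))
      (atTop ×ˢ atTop) (𝓝 0)

/-- `x` and `y` are in the form domain of `A`, and the closed sesquilinear form of `A`, that is the
closure of `(u, v) ↦ ⟪u, A v⟫` on `D(A)`, takes the value `w` at `(x, y)`. For `A` selfadjoint and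
`A ≥ a`, this is `w = ⟪(A - a)^(1/2) x, (A - a)^(1/2) y⟫ + a ⟪x, y⟫` with `x, y` in the domain of
`(A - a)^(1/2)`; for `x, y ∈ D(A)` it is `w = ⟪x, A y⟫`. -/
def IsFormValue (A : H →ₗ.[ℂ] H) (x y : H) (w : ℂ) : Prop :=
  ∃ u v : ℕ → A.domain, FormConverges A u x ∧ FormConverges A v y ∧
    Tendsto (fun n => inner ℂ (u n : H) (A (v n))) atTop (𝓝 w)

/-- `B : V → V` is the compression `π A|_V` of `A` to the subspace `V` of the form domain:
`⟪x, B y⟫` is the value at `(x, y)` of the form of `A`, for all `x, y ∈ V`. -/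
def IsCompression (A : H →ₗ.[ℂ] H) (V : Submodule ℂ H) (B : V →ₗ[ℂ] V) : Prop :=
  ∀ x y : V, IsFormValue A (x : H) (y : H) (inner ℂ (x : H) (B y : H))

open Classical in
/-- The compression `π A|_V : V → V` of a selfadjoint operator `A`, bounded from below, to a finite
dimensional subspace `V` of its form domain. -/
noncomputable def compression (A : H →ₗ.[ℂ] H) (V : Submodule ℂ H) : Module.End ℂ V :=
  if h : ∃ B : V →ₗ[ℂ] V, IsCompression A V B then h.choose else 0

/-! ### Limiting spectra -/

/-- The limiting spectrum `σ(A, L)`: limits of `μ k ∈ σ(A_{n k})` with `n k → ∞`. -/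
def limitingSpectrum (A : H →ₗ.[ℂ] H) (L : ℕ → Submodule ℂ H) : Set ℝ :=
  {t | ∃ (n : ℕ → ℕ) (μ : ℕ → ℝ), Tendsto n atTop atTop ∧
    (∀ k, (μ k : ℂ) ∈ spectrum ℂ (compression A (L (n k)))) ∧ Tendsto μ atTop (𝓝 t)}

/-- The limiting essential spectrum: the points `t` of `σ(A, L)` which have a singular Weyl
sequence: unit vectors `x k ∈ L (n k)`, `n k → ∞`, with `x k ⇀ 0` weakly in `H` and
`(A_{n k} - t) x k → 0`. -/
def limitingEssSpectrum (A : H →ₗ.[ℂ] H) (L : ℕ → Submodule ℂ H) : Set ℝ :=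
  {t | t ∈ limitingSpectrum A L ∧ ∃ (n : ℕ → ℕ) (x : (k : ℕ) → L (n k)), Tendsto n atTop atTop ∧
    (∀ k, ‖(x k : H)‖ = 1) ∧
    Tendsto (fun k => ‖compression A (L (n k)) (x k) - (t : ℂ) • x k‖) atTop (𝓝 0) ∧
    ∀ y : H, Tendsto (fun k => inner ℂ y (x k : H)) atTop (𝓝 0)}

end LimitingSpectra

/-!
The number `a` lies strictly to the left of the spectrum of `A`, so `A - a` has a bounded inverse
whose spectrum is nonnegative (`HasInverse.nonneg`). Every nonnegative selfadjoint square root `S`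
of `A - a` therefore has a bounded symmetric inverse `Q`, with `Q² = (A - a)⁻¹`
(`exists_hasInverse_opSqrt`). All unbounded operators are treated through such bounded inverses.

The closed form of `A` at `(Q s, Q s')` is `⟪s, s'⟫ + a ⟪Q s, Q s'⟫`
(`HasInverse.isFormValue_iff`). Fix `n`, and let `e` be the bijection from `W = G n = S (L n)`
to `V = L n` induced by `Q`. The compressions `B` of `A` to `V` and `C` of `(A - a)⁻¹` to `W` are
characterized by `⟪e w, (B - a) e w'⟫ = ⟪w, w'⟫` and `⟪w, C w'⟫ = ⟪e w, e w'⟫`, so that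
`(B - a) e C = e` (`apply_compression_inverse`) and `C e⁻¹ (B - a) = e⁻¹`
(`compression_inverse_apply`): `C` is similar to `(B - a)⁻¹`. Hence `t` is an eigenvalue of `B` if
and only if `t ≠ a` and `(t - a)⁻¹` is one of `C`, and `1 ≤ ‖Q‖² (t - a)` for every such `t`. As
this bound does not depend on `n`, limits of eigenvalues of the `B`'s differ from `a`, and the map
`t ↦ (t - a)⁻¹` passes to the limit (`mem_limitingSpectrum_iff`).

For the essential part, Weyl sequences are transported in both directions
(`mem_limitingEssSpectrum_iff`). If `x` is a Weyl sequence for the `B`'s at `t`, then `e⁻¹ x` is one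
for the `C`'s at `(t - a)⁻¹`: the residual is controlled since `‖C w‖ ≤ ‖Q‖ ‖e w‖`, and weak
convergence to zero is tested on the dense range of `Q`. Conversely, let `w` be a Weyl sequence for
the `C`'s. The obvious candidate `e w` does not work, as its residual involves the adjoint of `e⁻¹`,
which is not bounded uniformly in `n`. Instead `e C w` is used, which is asymptotically
`(t - a)⁻¹ e w` but satisfies `(B - t) e C w = -(t - a) e (C - (t - a)⁻¹) w`
(`norm_compression_sub_le`). The norms of the transported vectors have nonzero limits, so that they
can be normalized.
-/

namespace LimitingSpectra

variable {H : Type*} [NormedAddCommGroup H] [InnerProductSpace ℂ H]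

/-! ### Bounded inverses of unbounded operators -/

/-- The bounded operator `R`, defined on all of `H`, is the inverse of the unbounded operator `F`.
A point `z` lies outside `opSpectrum A` exactly when `shift A z` has an inverse in this sense. -/
def HasInverse (F : H →ₗ.[ℂ] H) (R : H →L[ℂ] H) : Prop :=
  ∀ x y : H, (x, y) ∈ F.graph ↔ R y = x

theorem mem_graph_shift {A : H →ₗ.[ℂ] H} {z : ℂ} {x y : H} :
    (x, y) ∈ (shift A z).graph ↔ (x, y + z • x) ∈ A.graph := by
  simp only [LinearPMap.mem_graph_iff]
  constructor
  · rintro ⟨u, rfl, hu⟩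
    refine ⟨u, rfl, ?_⟩
    rw [← hu]
    exact (sub_add_cancel (A u) (z • (u : H))).symm
  · rintro ⟨u, rfl, hu⟩
    exact ⟨u, rfl, sub_eq_of_eq_add hu⟩

theorem HasInverse.mem_graph {F : H →ₗ.[ℂ] H} {R : H →L[ℂ] H} (h : HasInverse F R) (y : H) :
    (R y, y) ∈ F.graph :=
  (h _ _).2 rfl

theorem HasInverse.injective {F : H →ₗ.[ℂ] H} {R : H →L[ℂ] H} (h : HasInverse F R) :
    Function.Injective R := by
  intro y y' hy
  exact F.mem_graph_snd_inj (h.mem_graph y) ((h _ _).2 hy.symm) rfl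

theorem HasInverse.mem_domain_iff {F : H →ₗ.[ℂ] H} {R : H →L[ℂ] H} (h : HasInverse F R) {x : H} :
    x ∈ F.domain ↔ ∃ y, R y = x := by
  rw [LinearPMap.mem_domain_iff]
  exact exists_congr fun y => h x y

theorem HasInverse.mem_graph_inverse {F : H →ₗ.[ℂ] H} {R : H →L[ℂ] H} (h : HasInverse F R)
    {x y : H} : (x, y) ∈ F.inverse.graph ↔ R x = y := by
  have hker : F.toFun.ker = ⊥ := by
    rw [LinearMap.ker_eq_bot']
    intro u hu
    have h1 : ((u : H), (0 : H)) ∈ F.graph := (LinearPMap.mem_graph_iff F).2 ⟨u, rfl, hu⟩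
    have h2 := (h _ _).1 h1
    rw [map_zero] at h2
    exact Subtype.ext h2.symm
  rw [LinearPMap.inverse_graph hker, ← h]
  simp [-LinearPMap.mem_graph_iff]

theorem inner_eq_of_mem_graph [CompleteSpace H] {F : H →ₗ.[ℂ] H} (hF : IsSelfAdjoint F)
    {x y x' y' : H} (h : (x, y) ∈ F.graph) (h' : (x', y') ∈ F.graph) :
    inner ℂ y x' = inner ℂ x y' := by
  have h1 : (x', y') ∈ F.graph.adjoint := by
    rw [← LinearPMap.adjoint_graph_eq_graph_adjoint hF.dense_domain,
      LinearPMap.isSelfAdjoint_def.1 hF]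
    exact h'
  exact sub_eq_zero.1 ((Submodule.mem_adjoint_iff _ _).1 h1 x y h)

theorem HasInverse.inner_comm_shift [CompleteSpace H] {A : H →ₗ.[ℂ] H} {a : ℝ} {R : H →L[ℂ] H}
    (h : HasInverse (shift A a) R) (hA : IsSelfAdjoint A) (x y : H) :
    inner ℂ (R x) y = inner ℂ x (R y) := by
  have h1 := inner_eq_of_mem_graph hA (mem_graph_shift.1 (h.mem_graph x))
    (mem_graph_shift.1 (h.mem_graph y))
  simp only [inner_add_left, inner_add_right, inner_smul_left, inner_smul_right,
    Complex.conj_ofReal] at h1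
  exact (add_right_cancel h1).symm

/-- The resolvents `R = (A - z)⁻¹` and `R' = (A - z')⁻¹` satisfy `R x = R' (x + (z - z') R x)`. -/
theorem HasInverse.resolvent_apply {A : H →ₗ.[ℂ] H} {z z' : ℂ} {R R' : H →L[ℂ] H}
    (h : HasInverse (shift A z) R) (h' : HasInverse (shift A z') R') (x : H) :
    R' (x + (z - z') • R x) = R x := by
  refine (h' _ _).1 (mem_graph_shift.2 ?_)
  have h1 := mem_graph_shift.1 (h.mem_graph x)
  convert h1 using 2
  module

/-- If no real point to the left of `a` is in the spectrum of `A`, then `(A - a)⁻¹` is nonnegative: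
for `ν < 0` the operator `(A - a)⁻¹ - ν` can be inverted with the help of the resolvent of `A`
at `a + 1 / ν < a`, so that the spectrum of `(A - a)⁻¹` is nonnegative. -/
theorem HasInverse.nonneg [CompleteSpace H] {A : H →ₗ.[ℂ] H} (hA : IsSelfAdjoint A) {a : ℝ}
    (ha : ∀ r : ℝ, r < a → (r : ℂ) ∉ opSpectrum A) {R : H →L[ℂ] H}
    (hR : HasInverse (shift A a) R) : 0 ≤ R := by
  have hsa : IsSelfAdjoint R := by
    rw [ContinuousLinearMap.isSelfAdjoint_iff_isSymmetric]
    exact hR.inner_comm_shift hA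
  rw [StarOrderedRing.nonneg_iff_spectrum_nonneg (R := ℝ) R hsa]
  intro ν hν
  by_contra! hneg
  obtain ⟨R', hR'⟩ := not_not.1 (ha (a + ν⁻¹) (by simpa using hneg))
  have hν0 : (ν : ℂ) ≠ 0 := by exact_mod_cast hneg.ne
  have e1 : ∀ x, R' (x - (ν : ℂ)⁻¹ • R x) = R x := by
    intro x
    have := hR.resolvent_apply hR' x
    push_cast at this
    convert this using 2
    module
  have e2 : ∀ x, R (x + (ν : ℂ)⁻¹ • R' x) = R' x := by
    intro x
    have := HasInverse.resolvent_apply hR' hR x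
    push_cast at this
    convert this using 2
    module
  refine hν ?_
  rw [spectrum.mem_resolventSet_iff, Algebra.algebraMap_eq_smul_one]
  -- The inverse of `ν - R` is `ν⁻¹ (1 + ν⁻¹ R')`, where `R'` is the resolvent of `A` at `a + ν⁻¹`.
  refine isUnit_iff_exists.2
    ⟨(ν : ℂ)⁻¹ • ((1 : H →L[ℂ] H) + (ν : ℂ)⁻¹ • R'), ?_, ?_⟩
  · ext x
    have h2 := e2 x
    simp only [map_add, map_smul] at h2
    simp only [mul_apply_eq_comp, sub_apply,
      smul_apply, one_apply_eq_self,
      add_apply, map_smul, map_add, RCLike.real_smul_eq_coe_smul (K := ℂ)]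
    rw [eq_sub_of_add_eq h2]
    simp only [RCLike.ofReal_eq_complex_ofReal, smul_add, smul_sub, smul_smul]
    match_scalars <;> field_simp <;> simp
  · ext x
    have h1 := e1 x
    simp only [map_sub, map_smul] at h1
    simp only [mul_apply_eq_comp, sub_apply,
      smul_apply, one_apply_eq_self,
      add_apply, map_smul, map_sub, RCLike.real_smul_eq_coe_smul (K := ℂ)]
    have h3 : R' x = R x + (ν : ℂ)⁻¹ • R' (R x) := eq_add_of_sub_eq h1
    rw [h3]
    simp only [RCLike.ofReal_eq_complex_ofReal, smul_add, smul_smul]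
    match_scalars <;> field_simp <;> simp

/-! ### The square root -/

theorem exists_hasInverse {Q : H →L[ℂ] H} (hQ : Function.Injective Q) :
    ∃ S : H →ₗ.[ℂ] H, HasInverse S Q := by
  have hker : (LinearMap.toPMap (Q : H →ₗ[ℂ] H) ⊤).toFun.ker = ⊥ := by
    rw [LinearMap.ker_eq_bot']
    intro u hu
    refine Subtype.ext (hQ ?_)
    rw [Submodule.coe_zero, map_zero]
    exact hu
  refine ⟨(LinearMap.toPMap (Q : H →ₗ[ℂ] H) ⊤).inverse, fun x y => ?_⟩
  rw [LinearPMap.inverse_graph hker]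
  simp

theorem denseRange_of_injective [CompleteSpace H] {Q : H →L[ℂ] H} (hQ : Function.Injective Q)
    (hsymm : ∀ x y, inner ℂ (Q x) y = inner ℂ x (Q y)) : DenseRange Q := by
  have h : (Q : H →ₗ[ℂ] H).rangeᗮ = ⊥ := by
    rw [LinearMap.IsSymmetric.orthogonal_range (T := (Q : H →ₗ[ℂ] H)) hsymm]
    exact LinearMap.ker_eq_bot.2 hQ
  exact Submodule.dense_iff_topologicalClosure_eq_top.2
    (Submodule.topologicalClosure_eq_top_iff.2 h)

/-- The inverse of an injective bounded symmetric operator is selfadjoint. -/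
theorem HasInverse.isSelfAdjoint [CompleteSpace H] {S : H →ₗ.[ℂ] H} {Q : H →L[ℂ] H}
    (hS : HasInverse S Q) (hsymm : ∀ x y, inner ℂ (Q x) y = inner ℂ x (Q y)) :
    IsSelfAdjoint S := by
  have hd : Dense (S.domain : Set H) := by
    have h1 : (S.domain : Set H) = Set.range Q := Set.ext fun x => hS.mem_domain_iff
    rw [h1]
    exact denseRange_of_injective hS.injective hsymm
  rw [LinearPMap.isSelfAdjoint_def]
  apply LinearPMap.eq_of_eq_graph
  rw [LinearPMap.adjoint_graph_eq_graph_adjoint hd]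
  ext ⟨x, y⟩
  rw [Submodule.mem_adjoint_iff, hS]
  constructor
  · intro h
    refine ext_inner_left ℂ fun v => ?_
    rw [← hsymm]
    exact (sub_eq_zero.1 (h _ _ (hS.mem_graph v))).symm
  · rintro rfl u v huv
    rw [← (hS _ _).1 huv, ← hsymm, sub_self]

/-- The inverse of the square root of the bounded operator `R = T⁻¹` is a square root of `T`, so that
`opSqrt T` takes no default value. -/
theorem HasInverse.exists_isSqrt [CompleteSpace H] {T : H →ₗ.[ℂ] H} {R : H →L[ℂ] H}
    (hT : HasInverse T R) (hR : 0 ≤ R) : ∃ S, IsSqrt S T := by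
  have hQQ : ∀ x, (CFC.sqrt R) ((CFC.sqrt R) x) = R x := fun x => by
    rw [← mul_apply_eq_comp, CFC.sqrt_mul_sqrt_self R hR]
  have hpos : (CFC.sqrt R).IsPositive :=
    (ContinuousLinearMap.nonneg_iff_isPositive _).1 (CFC.sqrt_nonneg R)
  generalize CFC.sqrt R = Q at hQQ hpos
  have hinj : Function.Injective Q := fun x y hxy => hT.injective <| by rw [← hQQ, ← hQQ, hxy]
  obtain ⟨S, hS⟩ := exists_hasInverse hinj
  refine ⟨S, hS.isSelfAdjoint fun x y => hpos.isSymmetric x y, fun x => ?_, fun x z => ?_⟩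
  · have h1 := (hS _ _).1 (S.mem_graph x)
    rw [← h1]
    exact hpos.re_inner_nonneg_left _
  · rw [hT, ← hQQ]
    constructor
    · rintro rfl
      exact ⟨Q z, hS.mem_graph _, hS.mem_graph _⟩
    · rintro ⟨y, h1, h2⟩
      rw [(hS _ _).1 h2, (hS _ _).1 h1]

/-- Any nonnegative selfadjoint square root of an operator with bounded inverse has a bounded
inverse itself: it is symmetric and everywhere defined, hence bounded by the Hellinger–Toeplitz
theorem. -/
theorem IsSqrt.exists_hasInverse [CompleteSpace H] {S T : H →ₗ.[ℂ] H} (hS : IsSqrt S T)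
    {R : H →L[ℂ] H} (hT : HasInverse T R) :
    ∃ Q : H →L[ℂ] H, HasInverse S Q ∧ (∀ x y, inner ℂ (Q x) y = inner ℂ x (Q y)) ∧
      ∀ x, Q (Q x) = R x := by
  obtain ⟨hsa, -, hgr⟩ := hS
  have hinj : Function.Injective S.toFun := by
    rw [injective_iff_map_eq_zero]
    intro u hu
    have h1 : ((u : H), (0 : H)) ∈ T.graph :=
      (hgr _ _).2 ⟨0, (LinearPMap.mem_graph_iff S).2 ⟨u, rfl, hu⟩, S.graph.zero_mem⟩
    have h2 := (hT _ _).1 h1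
    rw [map_zero] at h2
    exact Subtype.ext h2.symm
  have hsurj : Function.Surjective S.toFun := by
    intro z
    obtain ⟨y, -, h2⟩ := (hgr _ _).1 (hT.mem_graph z)
    obtain ⟨u, -, hu⟩ := (LinearPMap.mem_graph_iff S).1 h2
    exact ⟨u, hu⟩
  let e := LinearEquiv.ofBijective S.toFun ⟨hinj, hsurj⟩
  have hgS : ∀ x y : H, (x, y) ∈ S.graph ↔ (e.symm y : H) = x := by
    intro x y
    rw [LinearPMap.mem_graph_iff]
    constructor
    · rintro ⟨u, rfl, rfl⟩
      exact congrArg Subtype.val (e.symm_apply_apply u)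
    · rintro rfl
      exact ⟨e.symm y, rfl, e.apply_symm_apply y⟩
  let Q₀ : H →ₗ[ℂ] H := S.domain.subtype ∘ₗ e.symm.toLinearMap
  have hsymm : Q₀.IsSymmetric := fun x y =>
    (inner_eq_of_mem_graph hsa ((hgS _ _).2 rfl) ((hgS _ _).2 rfl)).symm
  refine ⟨⟨Q₀, hsymm.continuous⟩, hgS, hsymm, fun x => ?_⟩
  exact ((hT _ _).1 ((hgr _ _).2 ⟨Q₀ x, (hgS _ _).2 rfl, (hgS _ _).2 rfl⟩)).symm

/-! ### Closed quadratic forms -/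

theorem HasInverse.inner_apply {A : H →ₗ.[ℂ] H} {a : ℝ} {Q : H →L[ℂ] H}
    (hQ : HasInverse (shift A a) (Q ∘L Q)) (hsymm : ∀ x y, inner ℂ (Q x) y = inner ℂ x (Q y))
    {u v : A.domain} {s s' : H} (hs : Q s = u) (hs' : Q s' = v) :
    inner ℂ (u : H) (A v) = inner ℂ s s' + a * inner ℂ (u : H) (v : H) := by
  have h1 : ((v : H), A v - (a : ℂ) • (v : H)) ∈ (shift A a).graph := by
    rw [mem_graph_shift, sub_add_cancel]
    exact A.mem_graph v
  have h2 : Q (Q (A v - (a : ℂ) • (v : H))) = v := (hQ _ _).1 h1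
  have hinj : Function.Injective Q := hQ.injective.of_comp (f := Q) (g := Q)
  have h3 : Q (A v - (a : ℂ) • (v : H)) = s' := hinj (h2.trans hs'.symm)
  rw [← h3, ← hsymm, hs, inner_sub_right, inner_smul_right]
  ring

theorem HasInverse.exists_apply_eq {A : H →ₗ.[ℂ] H} {a : ℝ} {Q : H →L[ℂ] H}
    (hQ : HasInverse (shift A a) (Q ∘L Q)) (u : A.domain) : ∃ s, Q s = u := by
  obtain ⟨y, hy⟩ := hQ.mem_domain_iff.1 (show (u : H) ∈ (shift A a).domain from u.2)
  exact ⟨Q y, hy⟩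

/-- Convergence in the sense of the form of `A` is convergence in the graph norm of
`Q⁻¹ = (A - a)^(1/2)`. -/
theorem HasInverse.formConverges_iff [CompleteSpace H] {A : H →ₗ.[ℂ] H} {a : ℝ} {Q : H →L[ℂ] H}
    (hQ : HasInverse (shift A a) (Q ∘L Q)) (hsymm : ∀ x y, inner ℂ (Q x) y = inner ℂ x (Q y))
    {u : ℕ → A.domain} {x : H} :
    FormConverges A u x ↔
      ∃ (s : ℕ → H) (s₀ : H), (∀ n, Q (s n) = u n) ∧ Tendsto s atTop (𝓝 s₀) ∧ Q s₀ = x := by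
  have key : ∀ s : ℕ → H, (∀ n, Q (s n) = u n) → ∀ p : ℕ × ℕ,
      inner ℂ ((u p.1 - u p.2 : A.domain) : H) (A (u p.1 - u p.2)) =
        ((‖s p.1 - s p.2‖ ^ 2 + a * ‖(u p.1 : H) - u p.2‖ ^ 2 : ℝ) : ℂ) := by
    intro s hs p
    have h1 : Q (s p.1 - s p.2) = ((u p.1 - u p.2 : A.domain) : H) := by
      rw [map_sub, hs, hs, Submodule.coe_sub]
    rw [hQ.inner_apply hsymm h1 h1, inner_self_eq_norm_sq_to_K, inner_self_eq_norm_sq_to_K,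
      Submodule.coe_sub]
    push_cast
    rfl
  have cauchy : ∀ {s : ℕ → H}, CauchySeq s →
      Tendsto (fun p : ℕ × ℕ => ‖s p.1 - s p.2‖ ^ 2) (atTop ×ˢ atTop) (𝓝 0) := by
    intro s hs
    have h1 := (cauchySeq_iff_tendsto_dist_atTop_0.1 hs).pow 2
    simpa only [dist_eq_norm, prod_atTop_atTop_eq, ne_eq, OfNat.ofNat_ne_zero, not_false_eq_true,
      zero_pow] using h1
  constructor
  · rintro ⟨hu, hform⟩
    choose s hs using fun n => hQ.exists_apply_eq (u n)
    have h1 : Tendsto (fun p : ℕ × ℕ => ‖s p.1 - s p.2‖ ^ 2 + a * ‖(u p.1 : H) - u p.2‖ ^ 2)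
        (atTop ×ˢ atTop) (𝓝 0) := by
      have := (Complex.continuous_re.tendsto 0).comp hform
      simpa only [Function.comp_def, key s hs, Complex.ofReal_re, Complex.zero_re] using this
    have h2 := h1.sub ((cauchy hu.cauchySeq).const_mul a)
    simp only [add_sub_cancel_right, mul_zero, sub_zero] at h2
    have h3 : CauchySeq s := by
      rw [cauchySeq_iff_tendsto_dist_atTop_0, ← prod_atTop_atTop_eq]
      have := h2.sqrt
      simpa only [dist_eq_norm, Real.sqrt_sq (norm_nonneg _), Real.sqrt_zero] using this
    obtain ⟨s₀, hs₀⟩ := cauchySeq_tendsto_of_complete h3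
    refine ⟨s, s₀, hs, hs₀, tendsto_nhds_unique ((Q.continuous.tendsto s₀).comp hs₀) ?_⟩
    simpa only [Function.comp_def, hs] using hu
  · rintro ⟨s, s₀, hs, hs₀, rfl⟩
    have hu : Tendsto (fun n => (u n : H)) atTop (𝓝 (Q s₀)) := by
      have := (Q.continuous.tendsto s₀).comp hs₀
      simpa only [Function.comp_def, hs] using this
    refine ⟨hu, ?_⟩
    simp only [key s hs]
    have h1 := (cauchy hs₀.cauchySeq).add ((cauchy hu.cauchySeq).const_mul a)
    rw [mul_zero, add_zero] at h1
    exact (Complex.continuous_ofReal.tendsto 0).comp h1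

theorem HasInverse.exists_formConverges [CompleteSpace H] {A : H →ₗ.[ℂ] H} {a : ℝ}
    {Q : H →L[ℂ] H} (hQ : HasInverse (shift A a) (Q ∘L Q))
    (hsymm : ∀ x y, inner ℂ (Q x) y = inner ℂ x (Q y)) (s : H) :
    ∃ u : ℕ → A.domain, FormConverges A u (Q s) := by
  have hinj : Function.Injective Q := hQ.injective.of_comp (f := Q) (g := Q)
  obtain ⟨r, hr, hlim⟩ := mem_closure_iff_seq_limit.1 (denseRange_of_injective hinj hsymm s)
  choose z hz using hr
  have hdom : ∀ n, Q (r n) ∈ A.domain := fun n =>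
    hQ.mem_domain_iff.2 ⟨z n, by rw [← hz]; rfl⟩
  exact ⟨fun n => ⟨Q (r n), hdom n⟩,
    (hQ.formConverges_iff hsymm).2 ⟨r, s, fun _ => rfl, hlim, rfl⟩⟩

/-- The closed form of `A` on the range of `Q = (A - a)^(-1/2)`. -/
theorem HasInverse.isFormValue_iff [CompleteSpace H] {A : H →ₗ.[ℂ] H} {a : ℝ} {Q : H →L[ℂ] H}
    (hQ : HasInverse (shift A a) (Q ∘L Q)) (hsymm : ∀ x y, inner ℂ (Q x) y = inner ℂ x (Q y))
    {s s' : H} {w : ℂ} :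
    IsFormValue A (Q s) (Q s') w ↔ w = inner ℂ s s' + a * inner ℂ (Q s) (Q s') := by
  have hinj : Function.Injective Q := hQ.injective.of_comp (f := Q) (g := Q)
  have key : ∀ {u v : ℕ → A.domain}, FormConverges A u (Q s) → FormConverges A v (Q s') →
      Tendsto (fun n => inner ℂ (u n : H) (A (v n))) atTop
        (𝓝 (inner ℂ s s' + a * inner ℂ (Q s) (Q s'))) := by
    intro u v hu hv
    obtain ⟨p, p₀, hp, hp₀, hps⟩ := (hQ.formConverges_iff hsymm).1 hu
    obtain ⟨q, q₀, hq, hq₀, hqs⟩ := (hQ.formConverges_iff hsymm).1 hv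
    rw [hinj hps] at hp₀
    rw [hinj hqs] at hq₀
    simp only [fun n => hQ.inner_apply hsymm (hp n) (hq n)]
    exact (hp₀.inner hq₀).add ((hu.1.inner hv.1).const_mul _)
  constructor
  · rintro ⟨u, v, hu, hv, hw⟩
    exact tendsto_nhds_unique hw (key hu hv)
  · rintro rfl
    obtain ⟨u, hu⟩ := hQ.exists_formConverges hsymm s
    obtain ⟨v, hv⟩ := hQ.exists_formConverges hsymm s'
    exact ⟨u, v, hu, hv, key hu hv⟩

/-- The closed form of a bounded operator is the form of the operator itself. -/
theorem isFormValue_iff_of_bounded {F : H →ₗ.[ℂ] H} {R : H →L[ℂ] H}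
    (hF : ∀ x y, (x, y) ∈ F.graph ↔ R x = y) {x y : H} {w : ℂ} :
    IsFormValue F x y w ↔ w = inner ℂ x (R y) := by
  have happ : ∀ u : F.domain, F u = R u := fun u => ((hF _ _).1 (F.mem_graph u)).symm
  have hdom : ∀ z, z ∈ F.domain := fun z =>
    LinearPMap.mem_domain_iff.2 ⟨R z, (hF _ _).2 rfl⟩
  constructor
  · rintro ⟨u, v, hu, hv, hw⟩
    simp only [happ] at hw
    exact tendsto_nhds_unique hw (hu.1.inner ((R.continuous.tendsto y).comp hv.1))
  · rintro rfl
    have hconst : ∀ z, FormConverges F (fun _ => ⟨z, hdom z⟩) z := fun z =>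
      ⟨tendsto_const_nhds, by simp⟩
    refine ⟨_, _, hconst x, hconst y, ?_⟩
    simp only [happ]
    exact tendsto_const_nhds

/-! ### Compressions -/

/-- A form value determines the compression uniquely, so the choice in `compression` is harmless as
soon as some `K` represents the form of `F` on `V`. -/
theorem compression_eq {F : H →ₗ.[ℂ] H} {V : Submodule ℂ H} (K : V →ₗ[ℂ] V)
    (hK : ∀ (x y : V) (w : ℂ), IsFormValue F x y w ↔ w = inner ℂ x (K y)) :
    compression F V = K := by
  have hex : ∃ B : V →ₗ[ℂ] V, IsCompression F V B := ⟨K, fun x y => (hK x y _).2 rfl⟩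
  rw [compression, dif_pos hex]
  ext1 y
  refine ext_inner_left ℂ fun x => ?_
  exact (hK x y _).1 (hex.choose_spec x y)

/-- With `S = Q⁻¹`, the compression of `A` to `V` is `J† J + a`, where `J` is the restriction of `S`
to the finite dimensional space `V`. -/
theorem HasInverse.inner_compression [CompleteSpace H] {A : H →ₗ.[ℂ] H} {a : ℝ} {Q : H →L[ℂ] H}
    (hQ : HasInverse (shift A a) (Q ∘L Q)) (hsymm : ∀ x y, inner ℂ (Q x) y = inner ℂ x (Q y))
    {V W : Submodule ℂ H} [FiniteDimensional ℂ V] (e : W ≃ₗ[ℂ] V) (he : ∀ w, (e w : H) = Q w)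
    (w w' : W) :
    inner ℂ (e w) (compression A V (e w')) = inner ℂ w w' + a * inner ℂ (e w) (e w') := by
  have : CompleteSpace V := FiniteDimensional.complete ℂ V
  let J : V →L[ℂ] H := (W.subtype ∘ₗ e.symm.toLinearMap).toContinuousLinearMap
  have hJ : ∀ v, J v = e.symm v := fun _ => rfl
  let K : V →ₗ[ℂ] V := ((J.adjoint ∘L J + (a : ℂ) • 1 : V →L[ℂ] V) : V →ₗ[ℂ] V)
  have hK : ∀ x y : V, inner ℂ x (K y) =
      inner ℂ (e.symm x) (e.symm y) + a * inner ℂ x y := by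
    intro x y
    change inner ℂ x (J.adjoint (J y) + (a : ℂ) • y) = _
    rw [inner_add_right, inner_smul_right, ContinuousLinearMap.adjoint_inner_right, hJ, hJ]
    rfl
  rw [compression_eq K, hK, e.symm_apply_apply, e.symm_apply_apply]
  intro x y z
  obtain ⟨w, rfl⟩ := e.surjective x
  obtain ⟨w', rfl⟩ := e.surjective y
  rw [hK, he, he, hQ.isFormValue_iff hsymm, e.symm_apply_apply, e.symm_apply_apply,
    Submodule.coe_inner, Submodule.coe_inner, he, he]

/-- The compression of `T⁻¹ = Q²` to `W` is `J† J`, where `J` is the restriction of `Q` to `W`. -/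
theorem HasInverse.inner_compression_inverse [CompleteSpace H] {T : H →ₗ.[ℂ] H} {Q : H →L[ℂ] H}
    (hQ : HasInverse T (Q ∘L Q)) (hsymm : ∀ x y, inner ℂ (Q x) y = inner ℂ x (Q y))
    {V W : Submodule ℂ H} [FiniteDimensional ℂ W] (e : W ≃ₗ[ℂ] V) (he : ∀ w, (e w : H) = Q w)
    (w w' : W) :
    inner ℂ w (compression T.inverse W w') = inner ℂ (e w) (e w') := by
  have : CompleteSpace W := FiniteDimensional.complete ℂ W
  let J : W →L[ℂ] H := Q ∘L W.subtypeL
  let K : W →ₗ[ℂ] W := ((J.adjoint ∘L J : W →L[ℂ] W) : W →ₗ[ℂ] W)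
  have hK : ∀ x y : W, inner ℂ x (K y) = inner ℂ (Q x) (Q y) := fun x y =>
    ContinuousLinearMap.adjoint_inner_right J x (J y)
  rw [compression_eq K, hK, Submodule.coe_inner, he, he]
  intro x y z
  rw [hK, isFormValue_iff_of_bounded fun _ _ => hQ.mem_graph_inverse, hsymm]
  rfl

/-! ### Compressions related by a change of form -/

section Pencil

variable {V W : Type*} [NormedAddCommGroup V] [InnerProductSpace ℂ V] [NormedAddCommGroup W]
  [InnerProductSpace ℂ W] {B : Module.End ℂ V} {C : Module.End ℂ W} {e : W ≃ₗ[ℂ] V} {a c : ℝ}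

/-- `(B - a) e C = e` if `B - a` is the form `⟪e⁻¹ ·, e⁻¹ ·⟫` on `V` and `C` is the form
`⟪e ·, e ·⟫` on `W`. -/
theorem apply_compression_inverse
    (hB : ∀ w w', inner ℂ (e w) (B (e w')) = inner ℂ w w' + a * inner ℂ (e w) (e w'))
    (hC : ∀ w w', inner ℂ w (C w') = inner ℂ (e w) (e w')) (w : W) :
    B (e (C w)) = e w + (a : ℂ) • e (C w) := by
  refine ext_inner_left ℂ fun v => ?_
  obtain ⟨w', rfl⟩ := e.surjective v
  rw [hB, hC, inner_add_right, inner_smul_right]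

/-- `C e⁻¹ (B - a) = e⁻¹` if `B - a` is the form `⟪e⁻¹ ·, e⁻¹ ·⟫` on `V` and `C` is the form
`⟪e ·, e ·⟫` on `W`. -/
theorem compression_inverse_apply
    (hB : ∀ w w', inner ℂ (e w) (B (e w')) = inner ℂ w w' + a * inner ℂ (e w) (e w'))
    (hC : ∀ w w', inner ℂ w (C w') = inner ℂ (e w) (e w')) (v : V) :
    C (e.symm (B v - (a : ℂ) • v)) = e.symm v := by
  refine ext_inner_left ℂ fun w => ?_
  have h := hB w (e.symm v)
  rw [e.apply_symm_apply] at h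
  rw [hC, e.apply_symm_apply, inner_sub_right, inner_smul_right, h, add_sub_cancel_right]

/-- In finite dimensions, with `C` similar to `(B - a)⁻¹`, eigenvectors of `B` and `C` correspond to
each other under `e`. -/
theorem mem_spectrum_compression_iff [FiniteDimensional ℂ V] [FiniteDimensional ℂ W]
    (hB : ∀ w w', inner ℂ (e w) (B (e w')) = inner ℂ w w' + a * inner ℂ (e w) (e w'))
    (hC : ∀ w w', inner ℂ w (C w') = inner ℂ (e w) (e w')) {t : ℝ} :
    (t : ℂ) ∈ spectrum ℂ B ↔ t ≠ a ∧ (((t - a)⁻¹ : ℝ) : ℂ) ∈ spectrum ℂ C := by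
  simp only [← Module.End.hasEigenvalue_iff_mem_spectrum]
  constructor
  · intro h
    obtain ⟨v, hv⟩ := h.exists_hasEigenvector
    have h1 := compression_inverse_apply hB hC v
    rw [hv.apply_eq_smul, ← sub_smul, map_smul, map_smul] at h1
    have hne : e.symm v ≠ 0 := by simpa using hv.2
    have hta : t ≠ a := by
      rintro rfl
      rw [sub_self, zero_smul] at h1
      exact hne h1.symm
    have hta' : (t : ℂ) - a ≠ 0 := by exact_mod_cast sub_ne_zero.2 hta
    refine ⟨hta, Module.End.hasEigenvalue_of_hasEigenvector (x := e.symm v)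
      ⟨Module.End.mem_eigenspace_iff.2 ?_, hne⟩⟩
    push_cast
    rw [eq_inv_smul_iff₀ hta', h1]
  · rintro ⟨hta, h⟩
    have hta' : (t : ℂ) - a ≠ 0 := by exact_mod_cast sub_ne_zero.2 hta
    obtain ⟨w, hw⟩ := h.exists_hasEigenvector
    have h1 := apply_compression_inverse hB hC w
    rw [hw.apply_eq_smul, map_smul, map_smul] at h1
    push_cast at h1
    rw [inv_smul_eq_iff₀ hta', smul_add, smul_comm, smul_inv_smul₀ hta', ← add_smul,
      sub_add_cancel] at h1
    exact Module.End.hasEigenvalue_of_hasEigenvector (x := e w)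
      ⟨Module.End.mem_eigenspace_iff.2 h1, by simpa using hw.2⟩

theorem inner_self_compression_inverse
    (hC : ∀ w w', inner ℂ w (C w') = inner ℂ (e w) (e w')) (w : W) :
    inner ℂ w (C w) = ((‖e w‖ ^ 2 : ℝ) : ℂ) := by
  rw [hC, inner_self_eq_norm_sq_to_K]
  norm_cast

theorem norm_compression_inverse_le (hc : ∀ w, ‖e w‖ ≤ c * ‖w‖)
    (hC : ∀ w w', inner ℂ w (C w') = inner ℂ (e w) (e w')) (w : W) :
    ‖C w‖ ≤ c * ‖e w‖ := by
  rcases (norm_nonneg (C w)).eq_or_lt with h | h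
  · rw [← h]
    have := (norm_nonneg _).trans (hc w)
    by_cases h0 : w = 0
    · simp [h0]
    · have : 0 ≤ c := nonneg_of_mul_nonneg_left this (norm_pos_iff.2 h0)
      positivity
  · refine le_of_mul_le_mul_left ?_ h
    calc ‖C w‖ * ‖C w‖ = ‖inner ℂ (C w) (C w)‖ := by
          rw [inner_self_eq_norm_sq_to_K, norm_pow, RCLike.norm_ofReal, abs_norm, sq]
      _ = ‖inner ℂ (e (C w)) (e w)‖ := by rw [hC]
      _ ≤ ‖e (C w)‖ * ‖e w‖ := norm_inner_le_norm _ _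
      _ ≤ c * ‖C w‖ * ‖e w‖ := by gcongr; exact hc _
      _ = ‖C w‖ * (c * ‖e w‖) := by ring

/-- The eigenvalues of `B` stay away from `a`. -/
theorem one_le_of_mem_spectrum_compression [FiniteDimensional ℂ V] (hc : ∀ w, ‖e w‖ ≤ c * ‖w‖)
    (hB : ∀ w w', inner ℂ (e w) (B (e w')) = inner ℂ w w' + a * inner ℂ (e w) (e w'))
    {t : ℝ} (ht : (t : ℂ) ∈ spectrum ℂ B) : 1 ≤ c ^ 2 * (t - a) := by
  obtain ⟨v, hv⟩ := (Module.End.hasEigenvalue_iff_mem_spectrum.2 ht).exists_hasEigenvector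
  have hpos : 0 < ‖e.symm v‖ := norm_pos_iff.2 (by simpa using hv.2)
  have h1 := hB (e.symm v) (e.symm v)
  rw [e.apply_symm_apply, hv.apply_eq_smul, inner_smul_right, inner_self_eq_norm_sq_to_K,
    inner_self_eq_norm_sq_to_K] at h1
  have h2 : t * ‖v‖ ^ 2 = ‖e.symm v‖ ^ 2 + a * ‖v‖ ^ 2 := by
    apply Complex.ofReal_injective
    push_cast
    exact h1
  have h3 := hc (e.symm v)
  rw [e.apply_symm_apply] at h3
  have h4 : ‖v‖ ^ 2 ≤ c ^ 2 * ‖e.symm v‖ ^ 2 := by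
    rw [← mul_pow]
    exact pow_le_pow_left₀ (norm_nonneg _) h3 2
  have h5 : 0 < ‖v‖ ^ 2 := pow_pos (norm_pos_iff.2 hv.2) 2
  have h6 : ‖e.symm v‖ ^ 2 = (t - a) * ‖v‖ ^ 2 := by linarith
  rw [h6] at h4
  refine le_of_mul_le_mul_right ?_ h5
  linarith

theorem norm_compression_inverse_sub_le (hc : ∀ w, ‖e w‖ ≤ c * ‖w‖)
    (hB : ∀ w w', inner ℂ (e w) (B (e w')) = inner ℂ w w' + a * inner ℂ (e w) (e w'))
    (hC : ∀ w w', inner ℂ w (C w') = inner ℂ (e w) (e w')) {t : ℝ} (hta : t ≠ a) (v : V) :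
    ‖C (e.symm v) - (((t - a)⁻¹ : ℝ) : ℂ) • e.symm v‖ ≤
      c * |(t - a)⁻¹| * ‖B v - (t : ℂ) • v‖ := by
  have hta' : (t : ℂ) - a ≠ 0 := by exact_mod_cast sub_ne_zero.2 hta
  set m : ℂ := (((t - a)⁻¹ : ℝ) : ℂ) with hm
  have hm' : m * (t - a) = 1 := by
    rw [hm]
    push_cast
    exact inv_mul_cancel₀ hta'
  have h1 : C (e.symm v) - m • e.symm v = C (e.symm (v - m • (B v - (a : ℂ) • v))) := by
    rw [map_sub, map_sub, map_smul, map_smul, compression_inverse_apply hB hC]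
  have h2 : v - m • (B v - (a : ℂ) • v) = -m • (B v - (t : ℂ) • v) := by
    match_scalars
    · linear_combination -hm'
    · ring
  have h3 := norm_compression_inverse_le hc hC (e.symm (v - m • (B v - (a : ℂ) • v)))
  rw [← h1, e.apply_symm_apply, h2, norm_smul, norm_neg, hm, Complex.norm_real,
    Real.norm_eq_abs] at h3
  linarith

/-- The norm of `(B - t) e C w` is controlled by that of `(C - (t - a)⁻¹) w`. The vector `e w`
itself would not do here, since `(B - t) e w` involves the unbounded adjoint of `e⁻¹`. -/
theorem norm_compression_sub_le (hc : ∀ w, ‖e w‖ ≤ c * ‖w‖)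
    (hB : ∀ w w', inner ℂ (e w) (B (e w')) = inner ℂ w w' + a * inner ℂ (e w) (e w'))
    (hC : ∀ w w', inner ℂ w (C w') = inner ℂ (e w) (e w')) {t : ℝ} (hta : t ≠ a) (w : W) :
    ‖B (e (C w)) - (t : ℂ) • e (C w)‖ ≤
      |t - a| * c * ‖C w - (((t - a)⁻¹ : ℝ) : ℂ) • w‖ := by
  have hta' : (t : ℂ) - a ≠ 0 := by exact_mod_cast sub_ne_zero.2 hta
  set m : ℂ := (((t - a)⁻¹ : ℝ) : ℂ) with hm
  have hm' : m * (t - a) = 1 := by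
    rw [hm]
    push_cast
    exact inv_mul_cancel₀ hta'
  have h1 : B (e (C w)) - (t : ℂ) • e (C w) = -((t - a : ℝ) : ℂ) • e (C w - m • w) := by
    rw [apply_compression_inverse hB hC, map_sub, map_smul]
    push_cast
    match_scalars
    · linear_combination -hm'
    · ring
  rw [h1, norm_smul, norm_neg, Complex.norm_real, Real.norm_eq_abs, mul_assoc]
  gcongr
  exact hc _

/-- If `v` is an approximate eigenvector of `B` at `t`, then `‖e⁻¹ v‖² = ⟪v, (B - a) v⟫` is close
to `t - a`. -/
theorem abs_norm_sq_sub_le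
    (hB : ∀ w w', inner ℂ (e w) (B (e w')) = inner ℂ w w' + a * inner ℂ (e w) (e w'))
    (t : ℝ) {v : V} (hv : ‖v‖ = 1) :
    |‖e.symm v‖ ^ 2 - (t - a)| ≤ ‖B v - (t : ℂ) • v‖ := by
  have h1 := hB (e.symm v) (e.symm v)
  rw [e.apply_symm_apply, inner_self_eq_norm_sq_to_K, inner_self_eq_norm_sq_to_K, hv] at h1
  have h2 : ((‖e.symm v‖ ^ 2 - (t - a) : ℝ) : ℂ) = inner ℂ v (B v - (t : ℂ) • v) := by
    rw [inner_sub_right, inner_smul_right, inner_self_eq_norm_sq_to_K, hv, h1]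
    push_cast
    simp only [RCLike.ofReal_eq_complex_ofReal]
    ring
  rw [← Real.norm_eq_abs, ← Complex.norm_real, h2]
  have h3 := norm_inner_le_norm (𝕜 := ℂ) v (B v - (t : ℂ) • v)
  rwa [hv, one_mul] at h3

theorem abs_norm_sq_sub_le_compression_inverse
    (hC : ∀ w w', inner ℂ w (C w') = inner ℂ (e w) (e w'))
    (m : ℝ) {w : W} (hw : ‖w‖ = 1) :
    |‖e w‖ ^ 2 - m| ≤ ‖C w - (m : ℂ) • w‖ := by
  have h2 : ((‖e w‖ ^ 2 - m : ℝ) : ℂ) = inner ℂ w (C w - (m : ℂ) • w) := by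
    rw [inner_sub_right, inner_smul_right, inner_self_eq_norm_sq_to_K, hw,
      inner_self_compression_inverse hC]
    simp
  rw [← Real.norm_eq_abs, ← Complex.norm_real, h2]
  have h3 := norm_inner_le_norm (𝕜 := ℂ) w (C w - (m : ℂ) • w)
  rwa [hw, one_mul] at h3

theorem compression_inverse_ne_zero
    (hC : ∀ w w', inner ℂ w (C w') = inner ℂ (e w) (e w')) {w : W} (hw : w ≠ 0) : C w ≠ 0 := by
  intro h
  have h1 := inner_self_compression_inverse hC w
  rw [h, inner_zero_right] at h1
  have h2 : ‖e w‖ ^ 2 = 0 := by exact_mod_cast h1.symm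
  simp [hw] at h2

end Pencil

/-! ### Weak convergence and Weyl sequences -/

theorem tendsto_inner_of_denseRange {Q : H → H} (hQ : DenseRange Q) {w : ℕ → H} {r : ℝ}
    (hw : Tendsto (fun k => ‖w k‖) atTop (𝓝 r))
    (h : ∀ s, Tendsto (fun k => inner ℂ (Q s) (w k)) atTop (𝓝 0)) (y : H) :
    Tendsto (fun k => inner ℂ y (w k)) atTop (𝓝 0) := by
  have hr : 0 ≤ r := ge_of_tendsto' hw fun k => norm_nonneg _
  rw [Metric.tendsto_nhds]
  intro ε hε
  obtain ⟨s, hs⟩ := hQ.exists_dist_lt y (show 0 < ε / 2 / (r + 1) by positivity)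
  filter_upwards [hw.eventually_lt_const (lt_add_one r),
    Metric.tendsto_nhds.1 (h s) (ε / 2) (half_pos hε)] with k h1 h2
  rw [dist_zero_right] at h2 ⊢
  rw [dist_eq_norm] at hs
  calc ‖inner ℂ y (w k)‖ = ‖inner ℂ (y - Q s) (w k) + inner ℂ (Q s) (w k)‖ := by
        rw [inner_sub_left, sub_add_cancel]
    _ ≤ ‖y - Q s‖ * ‖w k‖ + ‖inner ℂ (Q s) (w k)‖ :=
        (norm_add_le _ _).trans (add_le_add_left (norm_inner_le_norm _ _) _)
    _ ≤ ε / 2 / (r + 1) * (r + 1) + ‖inner ℂ (Q s) (w k)‖ := by gcongr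
    _ < ε := by
        rw [div_mul_cancel₀ _ (by positivity)]
        linarith

/-- Weyl sequences need not be normalized: it suffices that the norms have a nonzero limit. -/
theorem mem_limitingEssSpectrum_of_tendsto {F : H →ₗ.[ℂ] H} {L : ℕ → Submodule ℂ H} {t : ℝ}
    (ht : t ∈ limitingSpectrum F L) {n : ℕ → ℕ} (hn : Tendsto n atTop atTop)
    (x : (k : ℕ) → L (n k)) (hx : ∀ k, x k ≠ 0) {r : ℝ} (hr : r ≠ 0)
    (hxr : Tendsto (fun k => ‖x k‖) atTop (𝓝 r))
    (hres : Tendsto (fun k => ‖compression F (L (n k)) (x k) - (t : ℂ) • x k‖) atTop (𝓝 0))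
    (hweak : ∀ y : H, Tendsto (fun k => inner ℂ y (x k : H)) atTop (𝓝 0)) :
    t ∈ limitingEssSpectrum F L := by
  have hinv := hxr.inv₀ hr
  refine ⟨ht, n, fun k => ((‖x k‖⁻¹ : ℝ) : ℂ) • x k, hn, fun k => ?_, ?_, fun y => ?_⟩
  · have h0 : ‖x k‖ ≠ 0 := norm_ne_zero_iff.2 (hx k)
    rw [← Submodule.coe_norm, norm_smul, Complex.norm_real, norm_inv, norm_norm, inv_mul_cancel₀ h0]
  · have h1 := hinv.mul hres
    rw [mul_zero] at h1
    refine h1.congr fun k => ?_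
    rw [map_smul, smul_comm, ← smul_sub, norm_smul, Complex.norm_real, norm_inv, norm_norm]
  · have h1 := ((Complex.continuous_ofReal.tendsto _).comp hinv).mul (hweak y)
    rw [mul_zero] at h1
    refine h1.congr fun k => ?_
    rw [Submodule.coe_smul, inner_smul_right]
    rfl

theorem tendsto_of_abs_sub_le {f g : ℕ → ℝ} {r : ℝ} (h : ∀ k, |f k - r| ≤ g k)
    (hg : Tendsto g atTop (𝓝 0)) : Tendsto f atTop (𝓝 r) := by
  rw [tendsto_iff_dist_tendsto_zero]
  exact squeeze_zero (fun _ => dist_nonneg) (fun k => by rw [Real.dist_eq]; exact h k) hg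

theorem tendsto_norm_of_sq {E : ℕ → Type*} [∀ k, NormedAddCommGroup (E k)] {x : ∀ k, E k} {r : ℝ}
    (h : Tendsto (fun k => ‖x k‖ ^ 2) atTop (𝓝 r)) :
    Tendsto (fun k => ‖x k‖) atTop (𝓝 (√r)) := by
  simpa only [Real.sqrt_sq (norm_nonneg _)] using h.sqrt

/-! ### The mapping of limiting spectra -/

section Mapping

variable {F F' : H →ₗ.[ℂ] H} {L G : ℕ → Submodule ℂ H} {e : ∀ n, G n ≃ₗ[ℂ] L n} {a c : ℝ}

theorem mem_limitingSpectrum_iff [∀ n, FiniteDimensional ℂ (L n)]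
    [∀ n, FiniteDimensional ℂ (G n)] (hc : ∀ n w, ‖e n w‖ ≤ c * ‖w‖)
    (hB : ∀ n w w', inner ℂ (e n w) (compression F (L n) (e n w')) =
      inner ℂ w w' + a * inner ℂ (e n w) (e n w'))
    (hC : ∀ n w w', inner ℂ w (compression F' (G n) w') = inner ℂ (e n w) (e n w')) {t : ℝ} :
    t ∈ limitingSpectrum F L ↔ t ≠ a ∧ (t - a)⁻¹ ∈ limitingSpectrum F' G := by
  constructor
  · rintro ⟨n, s, hn, hs, hst⟩
    have hta : t ≠ a := by
      rintro rfl
      have h1 : Tendsto (fun k => c ^ 2 * (s k - t)) atTop (𝓝 (c ^ 2 * (t - t))) :=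
        (hst.sub_const t).const_mul _
      have h2 := ge_of_tendsto' h1 fun k =>
        one_le_of_mem_spectrum_compression (hc (n k)) (hB (n k)) (hs k)
      simp at h2
      linarith
    exact ⟨hta, n, fun k => (s k - a)⁻¹, hn,
      fun k => ((mem_spectrum_compression_iff (hB (n k)) (hC (n k))).1 (hs k)).2,
      (hst.sub_const a).inv₀ (sub_ne_zero.2 hta)⟩
  · rintro ⟨hta, n, m, hn, hm, hmt⟩
    have hinv : (t - a)⁻¹ ≠ 0 := inv_ne_zero (sub_ne_zero.2 hta)
    have hev : ∀ᶠ k in atTop, m k ≠ 0 := hmt.eventually_ne hinv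
    obtain ⟨N, hN⟩ := eventually_atTop.1 hev
    -- Only for large `k` is `m k ≠ 0`, which excludes the junk value `0⁻¹ = 0`.
    refine ⟨fun k => n (k + N), fun k => a + (m (k + N))⁻¹,
      hn.comp (tendsto_add_atTop_nat N), fun k => ?_, ?_⟩
    · have h0 := hN (k + N) (Nat.le_add_left _ _)
      refine (mem_spectrum_compression_iff (hB _) (hC _)).2 ⟨by simpa using h0, ?_⟩
      rw [add_sub_cancel_left, inv_inv]
      exact hm _
    · have h1 := ((hmt.inv₀ hinv).comp (tendsto_add_atTop_nat N)).const_add a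
      rw [inv_inv, add_sub_cancel] at h1
      exact h1

theorem mem_limitingEssSpectrum_iff [∀ n, FiniteDimensional ℂ (L n)]
    [∀ n, FiniteDimensional ℂ (G n)] {Q : H →L[ℂ] H} (hdense : DenseRange Q)
    (hsymm : ∀ x y, inner ℂ (Q x) y = inner ℂ x (Q y)) (he : ∀ n w, (e n w : H) = Q w)
    (hc : ∀ n w, ‖e n w‖ ≤ c * ‖w‖)
    (hB : ∀ n w w', inner ℂ (e n w) (compression F (L n) (e n w')) =
      inner ℂ w w' + a * inner ℂ (e n w) (e n w'))
    (hC : ∀ n w w', inner ℂ w (compression F' (G n) w') = inner ℂ (e n w) (e n w')) {t : ℝ} :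
    t ∈ limitingEssSpectrum F L ↔ t ≠ a ∧ (t - a)⁻¹ ∈ limitingEssSpectrum F' G := by
  have hspec := mem_limitingSpectrum_iff (t := t) hc hB hC
  constructor
  · rintro ⟨ht, n, x, hn, hx, hres, hweak⟩
    obtain ⟨hta, hta'⟩ := hspec.1 ht
    have hsq : Tendsto (fun k => ‖(e (n k)).symm (x k)‖ ^ 2) atTop (𝓝 (t - a)) :=
      tendsto_of_abs_sub_le (fun k => abs_norm_sq_sub_le (hB (n k)) t (hx k)) hres
    have hnorm := tendsto_norm_of_sq hsq
    have hpos : 0 < t - a :=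
      (ge_of_tendsto' hsq fun k => sq_nonneg _).lt_of_ne' (sub_ne_zero.2 hta)
    refine ⟨hta, mem_limitingEssSpectrum_of_tendsto hta' hn (fun k => (e (n k)).symm (x k))
      (fun k => ?_) (Real.sqrt_pos.2 hpos).ne' hnorm ?_ ?_⟩
    · have h0 : x k ≠ 0 := fun h => by simpa [h] using hx k
      simpa using h0
    · refine squeeze_zero (fun _ => norm_nonneg _)
        (fun k => norm_compression_inverse_sub_le (hc (n k)) (hB (n k)) (hC (n k)) hta (x k)) ?_
      simpa using hres.const_mul (c * |(t - a)⁻¹|)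
    · refine tendsto_inner_of_denseRange hdense hnorm fun s => ?_
      refine (hweak s).congr fun k => ?_
      rw [hsymm, ← he, LinearEquiv.apply_symm_apply]
  · rintro ⟨hta, hμ, n, w, hn, hw, hres, hweak⟩
    have ht := hspec.2 ⟨hta, hμ⟩
    set μ : ℝ := (t - a)⁻¹ with hμdef
    have hμ0 : μ ≠ 0 := inv_ne_zero (sub_ne_zero.2 hta)
    have hsq : Tendsto (fun k => ‖e (n k) (w k)‖ ^ 2) atTop (𝓝 μ) :=
      tendsto_of_abs_sub_le
        (fun k => abs_norm_sq_sub_le_compression_inverse (hC (n k)) μ (hw k)) hres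
    have hpos : 0 < μ := (ge_of_tendsto' hsq fun k => sq_nonneg _).lt_of_ne' hμ0
    -- `e C w` is asymptotically `μ e w`, and `‖e w‖ → √μ`.
    have hnorm : Tendsto (fun k => ‖e (n k) (compression F' (G (n k)) (w k))‖) atTop
        (𝓝 (μ * √μ)) := by
      have h1 : Tendsto (fun k => ‖e (n k) (compression F' (G (n k)) (w k))‖ -
          μ * ‖e (n k) (w k)‖) atTop (𝓝 0) := by
        refine squeeze_zero_norm (fun k => ?_) (by simpa using hres.const_mul c)
        have h2 : μ * ‖e (n k) (w k)‖ = ‖e (n k) ((μ : ℂ) • w k)‖ := by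
          rw [map_smul, norm_smul, Complex.norm_real, Real.norm_eq_abs, abs_of_pos hpos]
        rw [h2]
        refine (abs_norm_sub_norm_le _ _).trans ?_
        rw [← map_sub]
        exact hc _ _
      have h3 := h1.add ((tendsto_norm_of_sq hsq).const_mul μ)
      simpa only [sub_add_cancel, zero_add] using h3
    refine mem_limitingEssSpectrum_of_tendsto ht hn
      (fun k => e (n k) (compression F' (G (n k)) (w k))) (fun k => ?_)
      (mul_pos hpos (Real.sqrt_pos.2 hpos)).ne' hnorm ?_ fun y => ?_
    · have h0 : w k ≠ 0 := fun h => by simpa [h] using hw k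
      simpa using compression_inverse_ne_zero (hC (n k)) h0
    · refine squeeze_zero (fun _ => norm_nonneg _)
        (fun k => norm_compression_sub_le (hc (n k)) (hB (n k)) (hC (n k)) hta (w k)) ?_
      have h1 := hres.const_mul (|t - a| * c)
      rw [mul_zero] at h1
      exact h1
    · have h1 : Tendsto (fun k => inner ℂ (Q y)
          ((compression F' (G (n k)) (w k) - (μ : ℂ) • w k : G (n k)) : H)) atTop (𝓝 0) :=
        squeeze_zero_norm (fun k => norm_inner_le_norm _ _)
          (by simpa using hres.const_mul ‖Q y‖)
      have h2 := h1.add ((hweak (Q y)).const_mul (μ : ℂ))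
      rw [mul_zero, add_zero] at h2
      refine h2.congr fun k => ?_
      rw [Submodule.coe_sub, Submodule.coe_smul, inner_sub_right, inner_smul_right,
        sub_add_cancel, hsymm, he]

end Mapping

/-- The subspace `S V` is the preimage of `V` under `Q = S⁻¹`, and `Q` maps it bijectively onto `V`. -/
theorem HasInverse.exists_equiv_imageSubspace {S : H →ₗ.[ℂ] H} {Q : H →L[ℂ] H}
    (hS : HasInverse S Q) {V : Submodule ℂ H} (hV : V ≤ S.domain) :
    ∃ e : imageSubspace S V ≃ₗ[ℂ] V, ∀ w, (e w : H) = Q w := by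
  have hmem : ∀ y, y ∈ imageSubspace S V ↔ Q y ∈ V := by
    intro y
    constructor
    · rintro ⟨u, hu, rfl⟩
      have h := (hS _ _).1 (S.mem_graph u)
      exact h.symm ▸ hu
    · intro hy
      obtain ⟨u, hu, huy⟩ := (LinearPMap.mem_graph_iff S).1 (hS.mem_graph y)
      refine ⟨u, ?_, huy⟩
      change (u : H) ∈ V
      rw [hu]
      exact hy
  let f : imageSubspace S V →ₗ[ℂ] V :=
    (Q : H →ₗ[ℂ] H).restrict fun y hy => (hmem y).1 hy
  refine ⟨LinearEquiv.ofBijective f ⟨fun y y' h => ?_, fun v => ?_⟩, fun w => rfl⟩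
  · exact Subtype.ext (hS.injective (congrArg Subtype.val h))
  · obtain ⟨y, hy⟩ := hS.mem_domain_iff.1 (hV v.2)
    exact ⟨⟨y, (hmem y).2 (by rw [hy]; exact v.2)⟩, Subtype.ext hy⟩

theorem notMem_opSpectrum_of_lt_infSpectrum {A : H →ₗ.[ℂ] H} {a r : ℝ}
    (ha : (a : EReal) < infSpectrum A) (hr : r ≤ a) : (r : ℂ) ∉ opSpectrum A := by
  intro h
  have h1 : infSpectrum A ≤ (r : EReal) :=
    iInf_le (fun μ : {μ : ℝ // (μ : ℂ) ∈ opSpectrum A} => ((μ : ℝ) : EReal)) ⟨r, h⟩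
  exact absurd (ha.trans_le h1) (not_lt.2 (EReal.coe_le_coe_iff.2 hr))

/-- The operator `Q = (A - a)^(-1/2)`. -/
theorem exists_hasInverse_opSqrt [CompleteSpace H] {A : H →ₗ.[ℂ] H} (hA : IsSelfAdjoint A) {a : ℝ}
    (ha : (a : EReal) < infSpectrum A) :
    ∃ Q : H →L[ℂ] H, HasInverse (opSqrt (shift A a)) Q ∧ HasInverse (shift A a) (Q ∘L Q) ∧
      ∀ x y, inner ℂ (Q x) y = inner ℂ x (Q y) := by
  obtain ⟨R, hR⟩ := not_not.1 (notMem_opSpectrum_of_lt_infSpectrum ha le_rfl)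
  have hex : ∃ S, IsSqrt S (shift A a) := HasInverse.exists_isSqrt hR <|
    HasInverse.nonneg hA (fun r hr => notMem_opSpectrum_of_lt_infSpectrum ha hr.le) hR
  have hS : IsSqrt (opSqrt (shift A a)) (shift A a) := by
    rw [opSqrt, dif_pos hex]
    exact hex.choose_spec
  obtain ⟨Q, hQ, hsymm, hQQ⟩ := hS.exists_hasInverse hR
  refine ⟨Q, hQ, fun x y => ?_, hsymm⟩
  rw [hR, ← hQQ]
  rfl

end LimitingSpectra

theorem theorem3p1 {H : Type*} [NormedAddCommGroup H] [InnerProductSpace ℂ H] [CompleteSpace H]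
    (A : H →ₗ.[ℂ] H) (hA : IsSelfAdjoint A) (hbdd : LimitingSpectra.BoundedBelow A)
    (a : ℝ) (ha : (a : EReal) < LimitingSpectra.infSpectrum A)
    (L : ℕ → Submodule ℂ H)
    (hL : LimitingSpectra.IsRegular (LimitingSpectra.opSqrt (LimitingSpectra.shift A a)) L)
    (G : ℕ → Submodule ℂ H)
    (hG : ∀ n, G n =
      LimitingSpectra.imageSubspace (LimitingSpectra.opSqrt (LimitingSpectra.shift A a)) (L n)) :
    (∀ t : ℝ, t ∈ LimitingSpectra.limitingSpectrum A L ↔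
      t ≠ a ∧ (t - a)⁻¹ ∈
        LimitingSpectra.limitingSpectrum (LimitingSpectra.shift A a).inverse G) ∧
    (∀ t : ℝ, t ∈ LimitingSpectra.limitingEssSpectrum A L ↔
      t ≠ a ∧ (t - a)⁻¹ ∈
        LimitingSpectra.limitingEssSpectrum (LimitingSpectra.shift A a).inverse G) := by
  obtain ⟨Q, hS, hQ, hsymm⟩ := LimitingSpectra.exists_hasInverse_opSqrt hA ha
  obtain ⟨hfin, hdom, -⟩ := hL
  obtain rfl : G = _ := funext hG
  choose e he using fun n => hS.exists_equiv_imageSubspace (hdom n)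
  have hfin' := fun n => Module.Finite.equiv (e n).symm
  have hc : ∀ n w, ‖e n w‖ ≤ ‖Q‖ * ‖w‖ := fun n w => by
    rw [Submodule.coe_norm, he]
    exact Q.le_opNorm w
  have hB := fun n => hQ.inner_compression hsymm (e n) (he n)
  have hC := fun n => hQ.inner_compression_inverse hsymm (e n) (he n)
  exact ⟨fun t => LimitingSpectra.mem_limitingSpectrum_iff hc hB hC,
    fun t => LimitingSpectra.mem_limitingEssSpectrum_iff
      (LimitingSpectra.denseRange_of_injective hS.injective hsymm) hsymm he hc hB hC⟩
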